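/- \textbf{Conventions.} A weighted graph $(V,c)$ has a finite or countable vertex set and a weight function $c:V\times V\to[0,\infty)$ with $c(x,x)=0$ and $c(x,y)=c(y,x)$; put $c_x=\sum_y c(x,y)\in[0,\infty]$. For a finite connected weighted graph, the effective resistance is $\phi^{xy}(x)$, where $\phi=\phi^{xy}:V\to\mathbb R$ is the solution of $\phi(z)-\sum_w\frac{c(z,w)}{c_z}\phi(w)=\frac1{c_x}\mathbf 1_x(z)-\frac1{c_y}\mathbf 1_y(z)$ for all $z\in V$, with $\phi(y)=0$. A Dirichlet form on a finite set $W$ is a quadratic form $F\ge 0$ on $\mathbb R^W$ such that $F(u)=0$ if and only if $u$ is constant, and $F(\min\{1,\max\{u,0\}\})\le F(u)$ for all $u$; let $R_F(x,y)=\left(\min\{F(u): u(x)=1,\ u(y)=0\}\right)^{-1}$ for $x\ne y$ and $R_F(x,x)=0$. A resistance metric on a set $V$ is a function $R:V\times V\to[0,\infty)$ such that for every finite $W\subseteq V$ there is a Dirichlet form $F$ on $W$ with $R|_{W\times W}=R_F$. \textbf{Theorem.} Let $R$ be a resistance metric on a countably infinite set $V$, let $(V_n)_{n\in\mathbb N}$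 be an increasing sequence of finite subsets of $V$ with $\bigcup_n V_n=V$, and for each $n$ let $G_n=(V_n,c_n)$ be the connected weighted graph with effective resistance $R|_{V_n\times V_n}$. Let $G_R=(V,c)$ be the limit graph, $c(x,y)=\lim_{n\to\infty}c_n(x,y)$. Assume that $$c_v=\lim_{n\to\infty}(c_n)_v<\infty\qquad\text{for all } v\in V,$$ and that the random walk of $G_R$, i.e. the Markov chain on $V$ with transition probabilities $c(v,w)/c_v$, is recurrent (started in any vertex it almost surely returns to it). Let $\mathbb E_x$ be the expectation for the random walk $(\omega_k)_{k\ge0}$ of $G_R$ started in $x$, and let $\tau_y=\inf\{k\ge0:\omega_k=y\}$. Then, for all $x,y\in V$, $$R(x,y)=\frac1{c_x}\,\mathbb E_x\left[\sum_{k=0}^{\tau_y-1}\mathbf 1_x(\omega_k)\right].$$ -/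

import Mathlib

open MeasureTheory ProbabilityTheory Filter Topology
open scoped ENNReal NNReal

noncomputable section

/-- A weighted graph on the vertex set `V`: a symmetric, non-negative weight function which
vanishes on the diagonal. Two vertices are adjacent if the weight between them is positive. -/
structure WeightedGraph (V : Type*) where
  weight : V → V → ℝ≥0
  weight_self : ∀ x, weight x x = 0
  weight_symm : ∀ x y, weight x y = weight y x

namespace WeightedGraph

variable {V : Type*}

/-- The vertex weight `c_x = ∑_y c(x, y)`, an element of `[0, ∞]`. -/
def vertexWeight (G : WeightedGraph V) (x : V) : ℝ≥0∞ :=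
  ∑' y, (G.weight x y : ℝ≥0∞)

/-- Any two vertices are joined by a finite path of edges of positive weight. -/
def Connected (G : WeightedGraph V) : Prop :=
  ∀ x y, Relation.ReflTransGen (fun a b => 0 < G.weight a b) x y

/-- The normalized Laplacian `(Δ f)(x) = f(x) - ∑_y (c(x, y) / c_x) f(y)` of a finite graph. -/
def laplacian [Fintype V] (G : WeightedGraph V) (f : V → ℝ) (x : V) : ℝ :=
  f x - ∑ y, (G.weight x y : ℝ) / (G.vertexWeight x).toReal * f y

/-- `φ` is a solution of the discrete Dirichlet problem
`Δ φ = (1 / c_x) 𝟙_x - (1 / c_y) 𝟙_y`, `φ(y) = 0`. -/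
def IsPotential [Fintype V] (G : WeightedGraph V) (x y : V) (φ : V → ℝ) : Prop :=
  (∀ z, G.laplacian φ z =
    Set.indicator {x} (fun _ => 1 / (G.vertexWeight x).toReal) z -
      Set.indicator {y} (fun _ => 1 / (G.vertexWeight y).toReal) z) ∧
  φ y = 0

/-- `R` is the effective resistance of the finite (connected) graph `G`: `R(x, y) = φ^{xy}(x)`,
where `φ^{xy}` solves the Dirichlet problem. On a connected finite graph the solution exists and
is unique. -/
def HasEffectiveResistance [Fintype V] (G : WeightedGraph V) (R : V → V → ℝ≥0) : Prop :=
  ∀ x y, ∃ φ : V → ℝ, G.IsPotential x y φ ∧ (R x y : ℝ) = φ x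

open Classical in
/-- A graph on a finite set of vertices `W ⊆ V`, viewed as a graph on `V` by giving weight zero to
all pairs that are not contained in `W`. -/
def extend {W : Finset V} (G : WeightedGraph W) : WeightedGraph V where
  weight x y := if h : x ∈ W ∧ y ∈ W then G.weight ⟨x, h.1⟩ ⟨y, h.2⟩ else 0
  weight_self x := by
    split_ifs with h
    · exact G.weight_self _
    · rfl
  weight_symm x y := by
    by_cases h : x ∈ W ∧ y ∈ W
    · rw [dif_pos h, dif_pos h.symm]
      exact G.weight_symm _ _
    · rw [dif_neg h, dif_neg (fun h' => h h'.symm)]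

/-- The limit graph of a sequence of graphs `(V_n, c_n)` with finite vertex sets `V_n ⊆ V`: the
graph on `V` with weights `c(x, y) = lim_n c_n(x, y)`. -/
def limitGraph {W : ℕ → Finset V} (G : ∀ n, WeightedGraph (W n)) : WeightedGraph V where
  weight x y := limUnder atTop (fun n => (G n).extend.weight x y)
  weight_self x := by
    simp only [weight_self]
    exact tendsto_const_nhds.limUnder_eq
  weight_symm x y := by
    simp only [fun n => (G n).extend.weight_symm x y]

/-- The distribution of one step of the random walk from `x`: `y` is chosen with probability
`c(x, y) / c_x`. (Where `c_x` is zero or infinite this is not defined and we let the walk stay.) -/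
def stepPMF (G : WeightedGraph V) (x : V) : PMF V :=
  open Classical in
  if h : ∑' y, (G.weight x y : ℝ≥0∞) ≠ 0 ∧ ∑' y, (G.weight x y : ℝ≥0∞) ≠ ∞ then
    PMF.normalize (fun y => (G.weight x y : ℝ≥0∞)) h.1 h.2
  else PMF.pure x

variable [MeasurableSpace V] [DiscreteMeasurableSpace V]

/-- The transition kernel of the random walk. -/
def stepKernel (G : WeightedGraph V) : Kernel V V where
  toFun x := (G.stepPMF x).toMeasure
  measurable' := Measurable.of_discrete

instance (G : WeightedGraph V) : IsMarkovKernel G.stepKernel :=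
  ⟨fun x => PMF.toMeasure.isProbabilityMeasure (G.stepPMF x)⟩

/-- The law `ℙ_x`, on the space of trajectories `ℕ → V`, of the random walk on `G` started in `x`:
the Markov chain with initial state `x` and transition kernel `stepKernel`. -/
def walk (G : WeightedGraph V) (x : V) : Measure (ℕ → V) :=
  Kernel.trajMeasure (X := fun _ => V) (Measure.dirac x) fun n =>
    G.stepKernel.comap (fun ω : (i : Finset.Iic n) → V => ω ⟨n, Finset.mem_Iic.2 le_rfl⟩)
      (measurable_pi_apply _)

end WeightedGraph

/-- The hitting time `τ_y(ω) = inf {k ≥ 0 | ω_k = y}`. -/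
def hitTime {V : Type*} (y : V) (ω : ℕ → V) : ℕ∞ :=
  ⨅ (k : ℕ) (_ : ω k = y), (k : ℕ∞)

/-- The return time `τ_y⁺(ω) = inf {k ≥ 1 | ω_k = y}`. -/
def returnTime {V : Type*} (y : V) (ω : ℕ → V) : ℕ∞ :=
  ⨅ (k : ℕ) (_ : 1 ≤ k ∧ ω k = y), (k : ℕ∞)

/-- The number of visits to `x` before the hitting time of `y`,
`∑_{k = 0}^{τ_y - 1} 𝟙_x(ω_k)`, an element of `[0, ∞]`. -/
def visitsBefore {V : Type*} (x y : V) (ω : ℕ → V) : ℝ≥0∞ :=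
  ∑' k : ℕ, Set.indicator {k : ℕ | (k : ℕ∞) < hitTime y ω ∧ ω k = x} (fun _ => 1) k

/-- The random walk on `G` is recurrent: started in any vertex, it almost surely returns there. -/
def WeightedGraph.Recurrent {V : Type*} [MeasurableSpace V] [DiscreteMeasurableSpace V]
    (G : WeightedGraph V) : Prop :=
  ∀ x, ∀ᵐ ω ∂(G.walk x), returnTime x ω < ⊤

/-- Dirichlet forms on a finite set. -/
structure IsDirichletForm {W : Type*} [Fintype W] (F : QuadraticForm ℝ (W → ℝ)) : Prop where
  nonneg : ∀ u, 0 ≤ F u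
  eq_zero_iff : ∀ u, F u = 0 ↔ ∀ x y, u x = u y
  markov : ∀ u : W → ℝ, F (fun x => min 1 (max (u x) 0)) ≤ F u

/-- `R_F(x, y) = (min {F(u) | u(x) = 1, u(y) = 0})⁻¹`. For `x = y` there is no such `u`, and the
value is `0`. -/
def dirichletResistance {W : Type*} [Fintype W] (F : QuadraticForm ℝ (W → ℝ)) (x y : W) : ℝ :=
  (sInf {e : ℝ | ∃ u : W → ℝ, u x = 1 ∧ u y = 0 ∧ F u = e})⁻¹

/-- `R` is a resistance metric on `V`: its restriction to every finite subset of `V` comes from a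
Dirichlet form. -/
def IsResistanceMetric {V : Type*} (R : V → V → ℝ≥0) : Prop :=
  ∀ W : Finset V, ∃ F : QuadraticForm ℝ (W → ℝ), IsDirichletForm F ∧
    ∀ x y : W, (R x y : ℝ) = dirichletResistance F x y

/-- A finite exhaustion of `V`. -/
structure IsFiniteExhaustion {V : Type*} (W : ℕ → Finset V) : Prop where
  mono : ∀ n, W n ⊆ W (n + 1)
  exhausts : ∀ x, ∃ n, x ∈ W n

end

/-! On every finite graph `G n` the potential with source `x` and sink `y` is `pot R x y z = (R(x,y)
+ R(z,y) - R(x,z)) / 2` (`HasEffectiveResistance.lap_pot`). This formula does not involve `n`, so a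
single function `f` on `V` solves all the finite Dirichlet problems at once. By the minimum
principle `0 ≤ f ≤ R(x,y)`; moreover `f(y) = 0` and `f(x) = R(x,y)`.

Enlarging the graph can only lower the weights (`HasEffectiveResistance.weight_le`), so they
converge. Since the vertex weights converge to those of the limit graph, no mass escapes to
infinity, and for bounded `f` the equation passes to the limit (`limitGraph_tsum_mul_pot`): `P f +
𝟙_x / c_x = f` off `y`, where `P` is the transition operator.

Iterating this along the walk from `x` gives `f(x) = E[f(ω_N); τ_y > N] + (1/c_x) E[visits to x
before min(N, τ_y)]`. Hence the expected number of visits before `τ_y` is finite. A recurrent walk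
visits `x` infinitely often, so it must hit `y` almost surely; as `f` is bounded, the remainder
tends to `0`. -/

namespace WeightedGraph

/-! ### Laplacian and minimum principle on finite graphs -/

section Finite

variable {V : Type*} [Fintype V] (G : WeightedGraph V)

/-- The unnormalized Laplacian `(L u)(z) = ∑_w c(z, w) (u(z) - u(w))` of a finite graph. -/
def lap (u : V → ℝ) (z : V) : ℝ := ∑ w, (G.weight z w : ℝ) * (u z - u w)

theorem lap_sub (u v : V → ℝ) (z : V) :
    G.lap (fun w => u w - v w) z = G.lap u z - G.lap v z := by
  simp only [lap, ← Finset.sum_sub_distrib]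
  exact Finset.sum_congr rfl fun w _ => by ring

theorem lap_const_mul (a : ℝ) (u : V → ℝ) (z : V) :
    G.lap (fun w => a * u w) z = a * G.lap u z := by
  simp only [lap, Finset.mul_sum]
  exact Finset.sum_congr rfl fun w _ => by ring

theorem lap_sum {ι : Type*} (s : Finset ι) (u : ι → V → ℝ) (z : V) :
    G.lap (fun w => ∑ i ∈ s, u i w) z = ∑ i ∈ s, G.lap (u i) z := by
  simp only [lap, ← Finset.sum_sub_distrib, Finset.mul_sum]
  exact Finset.sum_comm

theorem lap_const (a : ℝ) (z : V) : G.lap (fun _ => a) z = 0 := by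
  simp [lap]

theorem sum_mul_lap_comm (u v : V → ℝ) :
    ∑ z, v z * G.lap u z = ∑ z, u z * G.lap v z := by
  have key : ∀ u v : V → ℝ, ∑ z, v z * G.lap u z =
      ∑ z, ∑ w, (G.weight z w : ℝ) * (v z * u z) - ∑ z, ∑ w, (G.weight z w : ℝ) * (v z * u w) := by
    intro u v
    simp only [lap, ← Finset.sum_sub_distrib, Finset.mul_sum]
    exact Finset.sum_congr rfl fun z _ => Finset.sum_congr rfl fun w _ => by ring
  rw [key, key, Finset.sum_comm (f := fun z w => (G.weight z w : ℝ) * (v z * u w))]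
  congr 1
  · exact Finset.sum_congr rfl fun z _ => Finset.sum_congr rfl fun w _ => by ring
  · refine Finset.sum_congr rfl fun z _ => Finset.sum_congr rfl fun w _ => ?_
    rw [G.weight_symm, mul_comm (v w)]

theorem sum_lap (u : V → ℝ) : ∑ z, G.lap u z = 0 := by
  have h := G.sum_mul_lap_comm u (fun _ => 1)
  simpa [lap_const] using h

variable {G}

/-- Minimum principle: a function that is superharmonic off `S` is minimal on `S`. -/
theorem Connected.exists_mem_le (hG : G.Connected) {S : Set V} (hS : S.Nonempty) {u : V → ℝ}
    (hu : ∀ z ∉ S, 0 ≤ G.lap u z) : ∃ s ∈ S, ∀ z, u s ≤ u z := by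
  obtain ⟨t, ht⟩ := hS
  obtain ⟨m, -, hm⟩ := Finset.exists_min_image Finset.univ u ⟨t, Finset.mem_univ t⟩
  replace hm : ∀ z, u m ≤ u z := fun z => hm z (Finset.mem_univ z)
  have key : ∀ b, Relation.ReflTransGen (fun a b => 0 < G.weight a b) m b →
      (∃ s ∈ S, u s = u m) ∨ u b = u m := by
    intro b hb
    induction hb with
    | refl => exact .inr rfl
    | @tail b c _ hbc ih =>
      rcases ih with ih | ih
      · exact .inl ih
      by_cases hbS : b ∈ S
      · exact .inl ⟨b, hbS, ih⟩
      right
      -- At a minimum `b` outside `S` all terms of `lap u b` are nonpositive but their sum is not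
      -- negative; so all vanish, and the minimum spreads to the neighbours of `b`.
      have hterm : ∀ w ∈ Finset.univ, (G.weight b w : ℝ) * (u b - u w) ≤ 0 := fun w _ =>
        mul_nonpos_of_nonneg_of_nonpos (G.weight b w).2 (by linarith [hm w])
      have h0 : G.lap u b = 0 := le_antisymm (Finset.sum_nonpos hterm) (hu b hbS)
      have h1 := (Finset.sum_eq_zero_iff_of_nonpos hterm).1 h0 c (Finset.mem_univ c)
      have h2 : (0 : ℝ) < G.weight b c := by exact_mod_cast hbc
      rcases mul_eq_zero.1 h1 with h | h <;> linarith
  rcases key t (hG m t) with ⟨s, hs, h⟩ | h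
  · exact ⟨s, hs, fun z => h ▸ hm z⟩
  · exact ⟨t, ht, fun z => h ▸ hm z⟩

theorem Connected.eq_of_lap_eq_zero (hG : G.Connected) {u : V → ℝ} (hu : ∀ z, G.lap u z = 0)
    (x y : V) : u x = u y := by
  have key : ∀ x y, u x ≤ u y := fun x y => by
    obtain ⟨s, rfl, h⟩ := hG.exists_mem_le (Set.singleton_nonempty x) (fun z _ => (hu z).ge)
    exact h y
  exact le_antisymm (key x y) (key y x)

theorem vertexWeight_eq_sum (G : WeightedGraph V) (x : V) :
    G.vertexWeight x = ((∑ y, G.weight x y : ℝ≥0) : ℝ≥0∞) := by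
  rw [vertexWeight, tsum_fintype]
  push_cast
  rfl

theorem Connected.vertexWeight_ne_zero (hG : G.Connected) {x y : V} (hxy : x ≠ y) :
    (G.vertexWeight x).toReal ≠ 0 := by
  rw [vertexWeight_eq_sum, ENNReal.coe_toReal, NNReal.coe_ne_zero]
  intro h
  rcases (hG x y).cases_head with h' | ⟨c, hc, -⟩
  · exact hxy h'
  · exact hc.ne' (Finset.sum_eq_zero_iff.1 h c (Finset.mem_univ c))

open Classical in
theorem Connected.lap_of_isPotential (hG : G.Connected) {x y : V} {φ : V → ℝ}
    (h : G.IsPotential x y φ) (z : V) :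
    G.lap φ z = (if z = x then 1 else 0) - (if z = y then 1 else 0) := by
  by_cases hV : ∃ z', z ≠ z'
  · obtain ⟨z', hz'⟩ := hV
    have hz := hG.vertexWeight_ne_zero hz'
    have h1 := h.1 z
    have h2 : G.lap φ z = (G.vertexWeight z).toReal * G.laplacian φ z := by
      have h3 : (G.vertexWeight z).toReal = ∑ w, (G.weight z w : ℝ) := by
        rw [vertexWeight_eq_sum, ENNReal.coe_toReal, NNReal.coe_sum]
      rw [laplacian, mul_sub, Finset.mul_sum]
      conv_rhs => lhs; rw [h3]
      rw [Finset.sum_mul, lap, ← Finset.sum_sub_distrib]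
      refine Finset.sum_congr rfl fun w _ => ?_
      field_simp
    rw [h2, h1, mul_sub]
    congr 1
    · by_cases hx : z = x
      · subst hx; simp [hz]
      · simp [hx]
    · by_cases hy : z = y
      · subst hy; simp [hz]
      · simp [hy]
  -- With a single vertex `c_z = 0` and the normalized equation is void, but then `x = y = z` and
  -- both sides vanish.
  · push Not at hV
    rw [if_pos (hV x), if_pos (hV y), lap]
    simp [← hV]

end Finite

/-! ### Potentials and monotonicity of weights -/

/-- The potential `φ^{xy}` expressed by the effective resistance. -/
noncomputable def pot {V : Type*} (R : V → V → ℝ≥0) (x y z : V) : ℝ := (R x y + R z y - R x z) / 2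

section Resistance

variable {V : Type*} [Fintype V] {G : WeightedGraph V} {R : V → V → ℝ≥0}

open Classical in
-- Self-adjointness of `lap` gives the reciprocity `φ^{zy}(x) = φ^{xy}(z)`. By uniqueness `φ^{xz}`
-- and `φ^{xy} - φ^{zy}` differ by a constant; comparing their values at `x` and `z` yields the
-- formula for `pot`.
theorem HasEffectiveResistance.lap_pot (hR : G.HasEffectiveResistance R) (hG : G.Connected)
    (x y z : V) :
    G.lap (pot R x y) z = (if z = x then 1 else 0) - (if z = y then 1 else 0) := by
  choose φ hφ hRφ using hR
  have hl : ∀ x y z, G.lap (φ x y) z = (if z = x then 1 else 0) - (if z = y then 1 else 0) :=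
    fun x y z => hG.lap_of_isPotential (hφ x y) z
  have h0 : ∀ x y, φ x y y = 0 := fun x y => (hφ x y).2
  have hrec : ∀ x y z, φ z y x = φ x y z := by
    intro x y z
    have := G.sum_mul_lap_comm (φ x y) (φ z y)
    simpa [hl, mul_sub, Finset.sum_sub_distrib, h0] using this
  have hpot : pot R x y = φ x y := by
    funext z
    have h1 := hG.eq_of_lap_eq_zero (u := fun w => φ x z w - (φ x y w - φ z y w))
      (fun w => by rw [lap_sub, lap_sub, hl, hl, hl]; ring) x z
    simp only [h0] at h1
    rw [pot, hRφ x y, hRφ z y, hRφ x z]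
    linarith [hrec x y z]
  rw [hpot, hl]

theorem HasEffectiveResistance.self_eq_zero (hR : G.HasEffectiveResistance R) (x : V) :
    R x x = 0 := by
  obtain ⟨φ, hφ, h⟩ := hR x x
  rw [← NNReal.coe_eq_zero, h, hφ.2]

theorem HasEffectiveResistance.pot_right (hR : G.HasEffectiveResistance R) (x y : V) :
    pot R x y y = 0 := by
  simp [pot, hR.self_eq_zero]

theorem HasEffectiveResistance.pot_left (hR : G.HasEffectiveResistance R) (x y : V) :
    pot R x y x = R x y := by
  simp [pot, hR.self_eq_zero]

theorem HasEffectiveResistance.pot_nonneg (hR : G.HasEffectiveResistance R) (hG : G.Connected)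
    (x y z : V) : 0 ≤ pot R x y z := by
  classical
  obtain ⟨s, rfl, h⟩ := hG.exists_mem_le (Set.singleton_nonempty y) (u := pot R x y)
    (fun z hz => by rw [hR.lap_pot hG, if_neg (show z ≠ y from hz)]; split_ifs <;> norm_num)
  exact hR.pot_right x s ▸ h z

theorem HasEffectiveResistance.pot_le (hR : G.HasEffectiveResistance R) (hG : G.Connected)
    (x y z : V) : pot R x y z ≤ R x y := by
  classical
  obtain ⟨s, rfl, h⟩ := hG.exists_mem_le (Set.singleton_nonempty x)
    (u := fun w => -1 * pot R x y w)
    (fun z hz => by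
      rw [lap_const_mul, hR.lap_pot hG, if_neg (show z ≠ x from hz)]; split_ifs <;> norm_num)
  have := h z
  simp only [hR.pot_left] at this
  linarith

/-- The weights decrease when the graph is enlarged to a graph with compatible resistances. -/
theorem HasEffectiveResistance.weight_le {V' : Type*} [Fintype V'] {H : WeightedGraph V'}
    {R' : V' → V' → ℝ≥0} (i : V ↪ V') (hRR : ∀ x y, R x y = R' (i x) (i y))
    (hR : G.HasEffectiveResistance R) (hG : G.Connected)
    (hR' : H.HasEffectiveResistance R') (hH : H.Connected) (a b : V) :
    H.weight (i a) (i b) ≤ G.weight a b := by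
  classical
  by_cases hab : a = b
  · subst hab; simp [weight_self]
  -- The Laplacian of this `u` at `a` reads off minus the weight of `ab`. Its charges `s` have total
  -- zero, so `u` is a combination of potentials with sink `a`.
  set u : V → ℝ := fun z => if z = b then 1 else 0 with hu
  set s : V → ℝ := G.lap u with hs
  have hs0 : ∑ x, s x = 0 := G.sum_lap u
  have hpot : ∀ x y z, pot R' (i x) (i y) (i z) = pot R x y z := fun x y z => by
    simp [pot, hRR]
  have hsa : s a = -(G.weight a b : ℝ) := by
    simp [hs, lap, hu, hab]
  have hu_eq : ∀ z, u z = ∑ x, s x * pot R x a z := by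
    intro z
    have h1 := hG.eq_of_lap_eq_zero (u := fun w => u w - ∑ x, s x * pot R x a w)
      (fun w => by
        rw [lap_sub, lap_sum]
        simp only [lap_const_mul, hR.lap_pot hG, mul_sub, Finset.sum_sub_distrib]
        simp only [← Finset.sum_mul, hs0]
        simp [hs]) z a
    simp only [hR.pot_right] at h1
    have h2 : u a = 0 := by simp [hu, hab]
    simp only [h2, mul_zero, Finset.sum_const_zero] at h1
    linarith
  -- The same charges on `H` give the harmonic extension of `u`, since the potentials agree on `V`.
  -- It is nonnegative with values `0` at `i a` and `1` at `i b`, so its Laplacian `s a` at `i a` is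
  -- at most `-H.weight (i a) (i b)`.
  set v : V' → ℝ := fun w => ∑ x, s x * pot R' (i x) (i a) w with hv
  have hvi : ∀ z, v (i z) = u z := fun z => by simp only [hv, hpot, hu_eq z]
  have hlapv : ∀ w, H.lap v w = ∑ x, s x * (if w = i x then 1 else 0) := by
    intro w
    rw [hv, lap_sum]
    simp only [lap_const_mul, hR'.lap_pot hH, mul_sub, Finset.sum_sub_distrib]
    simp only [← Finset.sum_mul, hs0]
    simp
  have hv0 : ∀ w, 0 ≤ v w := by
    obtain ⟨_, ⟨z, rfl⟩, h⟩ := hH.exists_mem_le (S := Set.range i) ⟨i a, a, rfl⟩ (u := v)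
      (fun w hw => by
        rw [hlapv, Finset.sum_eq_zero]
        intro x _
        rw [if_neg (fun h => hw ⟨x, h.symm⟩), mul_zero])
    intro w
    refine le_trans ?_ (h w)
    rw [hvi, hu]
    dsimp only
    split_ifs <;> norm_num
  have h1 : H.lap v (i a) = s a := by
    rw [hlapv]; simp
  have h2 : H.lap v (i a) ≤ -(H.weight (i a) (i b) : ℝ) := by
    have hva : v (i a) = 0 := by rw [hvi]; simp [hu, hab]
    have hvb : v (i b) = 1 := by rw [hvi]; simp [hu]
    have h3 : (H.weight (i a) (i b) : ℝ) * v (i b) ≤ ∑ w, (H.weight (i a) w : ℝ) * v w :=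
      Finset.single_le_sum (f := fun w => (H.weight (i a) w : ℝ) * v w)
        (fun w _ => mul_nonneg (H.weight (i a) w).2 (hv0 w)) (Finset.mem_univ (i b))
    rw [lap, hva]
    simp only [zero_sub, mul_neg, Finset.sum_neg_distrib]
    rw [hvb, mul_one] at h3
    linarith
  have h4 : (H.weight (i a) (i b) : ℝ) ≤ G.weight a b := by linarith
  exact_mod_cast h4

end Resistance

end WeightedGraph

/-! ### Limits of sums without loss of mass -/

/-- Fatou's lemma for the counting measure. -/
theorem ENNReal.tsum_le_of_tendsto {V : Type*} {a : ℕ → V → ℝ≥0∞} {b : V → ℝ≥0∞} {s : ℝ≥0∞}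
    (hab : ∀ w, Tendsto (fun n => a n w) atTop (𝓝 (b w)))
    (hs : Tendsto (fun n => ∑' w, a n w) atTop (𝓝 s)) : ∑' w, b w ≤ s := by
  let _ : MeasurableSpace V := ⊤
  have h := lintegral_liminf_le (μ := Measure.count) (u := atTop) (f := a)
    (fun n => measurable_from_top)
  simp only [lintegral_count, hs.liminf_eq, fun w => (hab w).liminf_eq] at h
  exact h

/-- If `a n → b` pointwise without loss of mass, then sums against bounded functions converge. -/
theorem ENNReal.tsum_mul_eq_of_tendsto {V : Type*} {a : ℕ → V → ℝ≥0∞} {b f : V → ℝ≥0∞}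
    {M s : ℝ≥0∞} (hM : M ≠ ∞) (hf : ∀ w, f w ≤ M)
    (hab : ∀ w, Tendsto (fun n => a n w) atTop (𝓝 (b w)))
    (hsum : Tendsto (fun n => ∑' w, a n w) atTop (𝓝 (∑' w, b w))) (hb : ∑' w, b w ≠ ∞)
    (hs : Tendsto (fun n => ∑' w, a n w * f w) atTop (𝓝 s)) : ∑' w, b w * f w = s := by
  have hfM : ∀ w, f w + (M - f w) = M := fun w => add_tsub_cancel_of_le (hf w)
  have hf' : ∀ w, f w ≠ ∞ := fun w => ne_top_of_le_ne_top hM (hf w)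
  -- Fatou applied to both `f` and `M - f` gives the two inequalities, because the total mass
  -- converges.
  have hsplit : ∀ c : V → ℝ≥0∞, ∑' w, c w * f w + ∑' w, c w * (M - f w) = (∑' w, c w) * M := by
    intro c
    rw [← ENNReal.tsum_add, ← ENNReal.tsum_mul_right]
    simp only [← mul_add, hfM]
  have h1 : ∑' w, b w * f w ≤ s := ENNReal.tsum_le_of_tendsto
    (fun w => ENNReal.Tendsto.mul_const (hab w) (.inr (hf' w))) hs
  have hMsum : Tendsto (fun n => (∑' w, a n w) * M) atTop (𝓝 ((∑' w, b w) * M)) :=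
    ENNReal.Tendsto.mul_const hsum (.inr hM)
  have hbM : (∑' w, b w) * M ≠ ∞ := ENNReal.mul_ne_top hb hM
  have hsM : s ≤ (∑' w, b w) * M := le_of_tendsto_of_tendsto' hs hMsum fun n => by
    rw [← hsplit (a n)]; exact le_self_add
  have hs' : s ≠ ∞ := ne_top_of_le_ne_top hbM hsM
  have ht : Tendsto (fun n => ∑' w, a n w * (M - f w)) atTop (𝓝 ((∑' w, b w) * M - s)) := by
    refine (ENNReal.Tendsto.sub hMsum hs (.inl hbM)).congr' ?_
    filter_upwards [hs.eventually (gt_mem_nhds hs'.lt_top)] with n hn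
    rw [← hsplit (a n)]
    exact ENNReal.add_sub_cancel_left hn.ne
  have h2 : ∑' w, b w * (M - f w) ≤ (∑' w, b w) * M - s := ENNReal.tsum_le_of_tendsto
    (fun w => ENNReal.Tendsto.mul_const (hab w)
      (.inr (ne_top_of_le_ne_top hM tsub_le_self))) ht
  refine le_antisymm h1 ?_
  have h3 : s + ((∑' w, b w) * M - s) ≤ ∑' w, b w * f w + ((∑' w, b w) * M - s) := by
    rw [add_tsub_cancel_of_le hsM]
    conv_lhs => rw [← hsplit b]
    gcongr
  exact (ENNReal.add_le_add_iff_right (ne_top_of_le_ne_top hbM tsub_le_self)).1 h3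

/-! ### The Dirichlet problem on the limit graph -/

theorem IsFiniteExhaustion.monotone {V : Type*} {W : ℕ → Finset V} (hW : IsFiniteExhaustion W) :
    Monotone W :=
  monotone_nat_of_le_succ hW.mono

theorem IsFiniteExhaustion.eventually_mem {V : Type*} {W : ℕ → Finset V}
    (hW : IsFiniteExhaustion W) (x : V) : ∀ᶠ n in atTop, x ∈ W n := by
  obtain ⟨N, hN⟩ := hW.exhausts x
  exact eventually_atTop.2 ⟨N, fun n hn => hW.monotone hn hN⟩

namespace WeightedGraph

variable {V : Type*}

theorem extend_weight_of_mem {W : Finset V} (G : WeightedGraph W) {x y : V} (hx : x ∈ W)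
    (hy : y ∈ W) : G.extend.weight x y = G.weight ⟨x, hx⟩ ⟨y, hy⟩ :=
  dif_pos ⟨hx, hy⟩

theorem tsum_extend_weight_mul {W : Finset V} (G : WeightedGraph W) (z : W) (f : V → ℝ≥0∞) :
    ∑' w, (G.extend.weight z w : ℝ≥0∞) * f w = ∑ w : W, (G.weight z w : ℝ≥0∞) * f w := by
  rw [tsum_eq_sum (s := W), ← Finset.sum_coe_sort]
  · refine Finset.sum_congr rfl fun w _ => ?_
    rw [extend_weight_of_mem G z.2 w.2]
  · intro w hw
    have h : G.extend.weight z w = 0 := dif_neg fun h => hw h.2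
    simp [h]

variable {R : V → V → ℝ≥0} {W : ℕ → Finset V} {G : ∀ n, WeightedGraph (W n)}

theorem tendsto_extend_weight (hW : IsFiniteExhaustion W) (hconn : ∀ n, (G n).Connected)
    (hres : ∀ n, (G n).HasEffectiveResistance (fun x y => R x y)) (x y : V) :
    Tendsto (fun n => (G n).extend.weight x y) atTop (𝓝 ((limitGraph G).weight x y)) := by
  obtain ⟨N, hx, hy⟩ := ((hW.eventually_mem x).and (hW.eventually_mem y)).exists
  have hmem : ∀ n, x ∈ W (n + N) ∧ y ∈ W (n + N) := fun n =>
    ⟨hW.monotone (Nat.le_add_left N n) hx, hW.monotone (Nat.le_add_left N n) hy⟩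
  -- The shift by `N` matters: `extend` gives weight `0` until both vertices are present, so the
  -- unshifted sequence may first jump up.
  have hanti : Antitone fun n => (G (n + N)).extend.weight x y := by
    refine antitone_nat_of_succ_le fun n => ?_
    have hsub : W (n + N) ⊆ W (n + 1 + N) := hW.monotone (by omega)
    rw [extend_weight_of_mem _ (hmem n).1 (hmem n).2,
      extend_weight_of_mem _ (hmem (n + 1)).1 (hmem (n + 1)).2]
    exact (hres (n + N)).weight_le (V := W (n + N)) (V' := W (n + 1 + N))
      ⟨fun a => (⟨a, hsub a.2⟩ : W (n + 1 + N)), fun a b h => Subtype.ext (congrArg (·.1) h)⟩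
      (fun _ _ => rfl) (hconn _) (hres (n + 1 + N)) (hconn _)
      ⟨x, (hmem n).1⟩ ⟨y, (hmem n).2⟩
  have h := (tendsto_add_atTop_iff_nat (f := fun n => (G n).extend.weight x y) N).1
    (tendsto_atTop_ciInf hanti (OrderBot.bddBelow _))
  exact tendsto_nhds_limUnder ⟨_, h⟩

theorem pot_mem_Icc (hW : IsFiniteExhaustion W) (hconn : ∀ n, (G n).Connected)
    (hres : ∀ n, (G n).HasEffectiveResistance (fun x y => R x y)) (x y z : V) :
    pot R x y z ∈ Set.Icc 0 (R x y : ℝ) := by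
  obtain ⟨n, hx, hy, hz⟩ := ((hW.eventually_mem x).and
    ((hW.eventually_mem y).and (hW.eventually_mem z))).exists
  exact ⟨(hres n).pot_nonneg (hconn n) ⟨x, hx⟩ ⟨y, hy⟩ ⟨z, hz⟩,
    (hres n).pot_le (hconn n) ⟨x, hx⟩ ⟨y, hy⟩ ⟨z, hz⟩⟩

theorem self_eq_zero_of_exhaustion (hW : IsFiniteExhaustion W)
    (hres : ∀ n, (G n).HasEffectiveResistance (fun x y => R x y)) (x : V) : R x x = 0 := by
  obtain ⟨n, hx⟩ := hW.exhausts x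
  exact (hres n).self_eq_zero ⟨x, hx⟩

open Classical in
/-- The potential solves the Dirichlet problem on the limit graph. -/
theorem limitGraph_tsum_mul_pot (hW : IsFiniteExhaustion W) (hconn : ∀ n, (G n).Connected)
    (hres : ∀ n, (G n).HasEffectiveResistance (fun x y => R x y))
    (hlim : ∀ v : V, (limitGraph G).vertexWeight v < ∞ ∧
      Tendsto (fun n => (G n).extend.vertexWeight v) atTop (𝓝 ((limitGraph G).vertexWeight v)))
    (x : V) {y z : V} (hz : z ≠ y) :
    ∑' w, ((limitGraph G).weight z w : ℝ≥0∞) * ENNReal.ofReal (pot R x y w) +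
      (if z = x then 1 else 0) = (limitGraph G).vertexWeight z * ENNReal.ofReal (pot R x y z) := by
  have hpot := pot_mem_Icc hW hconn hres x y
  -- The source term is moved to the left so that every term is nonnegative and the equation makes
  -- sense in `ℝ≥0∞`.
  have hev : ∀ᶠ n in atTop,
      ∑' w, ((G n).extend.weight z w : ℝ≥0∞) * ENNReal.ofReal (pot R x y w) +
        (if z = x then 1 else 0) = (G n).extend.vertexWeight z * ENNReal.ofReal (pot R x y z) := by
    filter_upwards [hW.eventually_mem x, hW.eventually_mem y, hW.eventually_mem z] with n hx hy hz'
    have h := (hres n).lap_pot (hconn n) ⟨x, hx⟩ ⟨y, hy⟩ ⟨z, hz'⟩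
    simp only [Subtype.mk.injEq, if_neg hz, sub_zero, lap, mul_sub,
      Finset.sum_sub_distrib] at h
    have h1 : (G n).extend.vertexWeight z =
        ∑ w : W n, ((G n).weight ⟨z, hz'⟩ w : ℝ≥0∞) * 1 := by
      rw [← tsum_extend_weight_mul (G n) ⟨z, hz'⟩ (fun _ => 1)]
      simp [vertexWeight]
    rw [tsum_extend_weight_mul (G n) ⟨z, hz'⟩, h1, Finset.sum_mul]
    have hconv : ∀ w v : V, ∀ hw : w ∈ W n, ((G n).weight ⟨z, hz'⟩ ⟨w, hw⟩ : ℝ≥0∞) *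
        ENNReal.ofReal (pot R x y v) =
        ENNReal.ofReal ((G n).weight ⟨z, hz'⟩ ⟨w, hw⟩ * pot R x y v) := fun w v hw => by
      rw [ENNReal.ofReal_mul (NNReal.coe_nonneg _), ENNReal.ofReal_coe_nnreal]
    have hite : (if z = x then 1 else 0 : ℝ≥0∞) = ENNReal.ofReal (if z = x then 1 else 0) := by
      split_ifs <;> simp
    have hnn : ∀ w v : V, ∀ hw : w ∈ W n,
        0 ≤ ((G n).weight ⟨z, hz'⟩ ⟨w, hw⟩ : ℝ) * pot R x y v :=
      fun w v hw => mul_nonneg (NNReal.coe_nonneg _) (hpot v).1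
    simp only [mul_one]
    rw [Finset.sum_congr rfl fun (w : W n) _ => hconv w w w.2,
      Finset.sum_congr rfl fun (w : W n) _ => hconv w z w.2,
      ← ENNReal.ofReal_sum_of_nonneg fun (w : W n) _ => hnn w w w.2,
      ← ENNReal.ofReal_sum_of_nonneg fun (w : W n) _ => hnn w z w.2, hite,
      ← ENNReal.ofReal_add (Finset.sum_nonneg fun (w : W n) _ => hnn w w w.2)
        (by split_ifs <;> norm_num), ← h]
    congr 1
    exact add_sub_cancel _ _
  have hzlim : Tendsto (fun n => (G n).extend.vertexWeight z * ENNReal.ofReal (pot R x y z)) atTop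
      (𝓝 ((limitGraph G).vertexWeight z * ENNReal.ofReal (pot R x y z))) :=
    ENNReal.Tendsto.mul_const (hlim z).2 (.inr ENNReal.ofReal_ne_top)
  have hδ : (if z = x then 1 else 0 : ℝ≥0∞) ≠ ∞ := by split_ifs <;> simp
  have hfin : (limitGraph G).vertexWeight z * ENNReal.ofReal (pot R x y z) ≠ ∞ :=
    ENNReal.mul_ne_top (hlim z).1.ne ENNReal.ofReal_ne_top
  have hle : (if z = x then 1 else 0 : ℝ≥0∞) ≤
      (limitGraph G).vertexWeight z * ENNReal.ofReal (pot R x y z) :=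
    ge_of_tendsto hzlim (hev.mono fun n hn => hn ▸ le_add_self)
  rw [ENNReal.tsum_mul_eq_of_tendsto (M := ENNReal.ofReal (R x y))
    (a := fun n w => ((G n).extend.weight z w : ℝ≥0∞)) ENNReal.ofReal_ne_top
    (fun w => ENNReal.ofReal_le_ofReal (hpot w).2)
    (fun w => ENNReal.tendsto_coe.2 (tendsto_extend_weight hW hconn hres z w))
    (hlim z).2 (hlim z).1.ne
    ((ENNReal.Tendsto.sub hzlim tendsto_const_nhds (.inr hδ)).congr'
      (hev.mono fun n hn => by rw [← hn]; exact ENNReal.add_sub_cancel_right hδ)),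
    tsub_add_cancel_of_le hle]

end WeightedGraph

/-! ### Markov property and recurrence of the walk -/

namespace WeightedGraph

section Walk

variable {V : Type*} [MeasurableSpace V] [DiscreteMeasurableSpace V]

instance (G : WeightedGraph V) (x : V) : IsProbabilityMeasure (G.walk x) := by
  unfold walk; infer_instance

/-- The transition operator `(P g)(z) = ∑_w p(z, w) g(w)` of the random walk. -/
noncomputable def stepOp (G : WeightedGraph V) (g : V → ℝ≥0∞) (z : V) : ℝ≥0∞ := ∫⁻ w, g w ∂(G.stepKernel z)

variable [Countable V] (G : WeightedGraph V)

theorem stepOp_eq {z : V} (h0 : G.vertexWeight z ≠ 0) (htop : G.vertexWeight z ≠ ∞)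
    (g : V → ℝ≥0∞) :
    G.stepOp g z = (G.vertexWeight z)⁻¹ * ∑' w, (G.weight z w : ℝ≥0∞) * g w := by
  rw [stepOp, lintegral_countable', ← ENNReal.tsum_mul_left]
  refine tsum_congr fun w => ?_
  have h1 : G.stepKernel z {w} = G.stepPMF z w :=
    PMF.toMeasure_apply_singleton _ _ (measurableSet_singleton w)
  have h2 : G.stepPMF z w = G.weight z w * (G.vertexWeight z)⁻¹ := by
    rw [stepPMF, dif_pos ⟨h0, htop⟩]
    rfl
  rw [h1, h2]
  ring

theorem walk_ae_zero (x : V) : ∀ᵐ ω ∂(G.walk x), ω 0 = x := by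
  have h : (G.walk x).map (Preorder.frestrictLe 0) = Measure.dirac (fun _ => x) := by
    rw [walk, Kernel.trajMeasure, Measure.map_dirac' (MeasurableEquiv.measurable _),
      Measure.map_comp _ _ (by fun_prop),
      Kernel.traj_map_frestrictLe, Kernel.partialTraj_self, Measure.id_comp]
    rfl
  have h2 : ∀ᵐ η ∂((G.walk x).map (Preorder.frestrictLe 0)),
      η ⟨0, Finset.mem_Iic.2 le_rfl⟩ = x := by
    rw [h]
    exact (ae_dirac_iff (measurableSet_eq_fun (by fun_prop) (by fun_prop))).2 rfl
  exact ae_of_ae_map (by fun_prop) h2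

/-- The Markov property of the random walk at time `n`. -/
theorem lintegral_mul_succ (x : V) {n : ℕ} {F : (ℕ → V) → ℝ≥0∞} (hF : DependsOn F (Set.Iic n))
    (g : V → ℝ≥0∞) :
    ∫⁻ ω, F ω * g (ω (n + 1)) ∂(G.walk x) = ∫⁻ ω, F ω * G.stepOp g (ω n) ∂(G.walk x) := by
  -- `F` factors through the path up to time `n`; padding with `x` afterwards is arbitrary.
  set F' : (Finset.Iic n → V) → ℝ≥0∞ :=
    fun η => F fun i => if h : i ≤ n then η ⟨i, Finset.mem_Iic.2 h⟩ else x with hF'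
  have hFF : ∀ ω, F ω = F' (Preorder.frestrictLe n ω) := fun ω => hF fun i hi => by
    simp [show i ≤ n from hi]
  have hF'm : Measurable F' := Measurable.of_discrete
  have hgm : Measurable g := Measurable.of_discrete
  have hκ := Kernel.map_frestrictLe_trajMeasure_compProd_eq_map_trajMeasure (X := fun _ => V)
    (μ₀ := Measure.dirac x) (a := n)
    (κ := fun n => G.stepKernel.comap (fun ω : (i : Finset.Iic n) → V =>
      ω ⟨n, Finset.mem_Iic.2 le_rfl⟩) (measurable_pi_apply _))
  have hHm : Measurable fun p : (Finset.Iic n → V) × V => F' p.1 * g p.2 := by fun_prop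
  have h1 := congrArg (fun μ => ∫⁻ p, F' p.1 * g p.2 ∂μ) hκ
  rw [lintegral_map hHm (by fun_prop), Measure.lintegral_compProd hHm] at h1
  simp only [lintegral_const_mul _ hgm] at h1
  rw [lintegral_map (Measurable.of_discrete) (by fun_prop)] at h1
  simp only [hFF]
  exact h1.symm

variable {G}

/-- Peeling off the last step, each step applies the transition operator killed at `y`; the time `k`
enters only through the first factor. Avoidance starts at time `k + 1`, so `x = y` is allowed and
describes returns. -/
theorem walk_apply_visit_succ (x y : V) (k m : ℕ) (g : V → ℝ≥0∞) :
    ∫⁻ ω, {ω : ℕ → V | ω k = x ∧ ∀ i, i < m → ω (k + i + 1) ≠ y}.indicator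
        (fun ω => g (ω (k + m))) ω ∂(G.walk x) =
      G.walk x {ω | ω k = x} * (fun g => G.stepOp (({y}ᶜ : Set V).indicator g))^[m] g x := by
  induction m generalizing g with
  | zero =>
    have hm : MeasurableSet {ω : ℕ → V | ω k = x} :=
      measurableSet_eq_fun (by fun_prop) (by fun_prop)
    rw [← mul_comm, ← lintegral_indicator_const hm]
    refine lintegral_congr fun ω => ?_
    by_cases h : ω k = x <;> simp [h]
  | succ m ih =>
    rw [Function.iterate_succ_apply, ← ih]
    set A : Set (ℕ → V) := {ω | ω k = x ∧ ∀ i, i < m → ω (k + i + 1) ≠ y} with hA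
    have hdep : DependsOn (A.indicator (1 : (ℕ → V) → ℝ≥0∞)) (Set.Iic (k + m)) := by
      intro ω ω' h
      have hiff : ω ∈ A ↔ ω' ∈ A := by
        simp only [hA, Set.mem_ofPred_eq]
        rw [h k (by simp)]
        refine and_congr_right fun _ => forall₂_congr fun i hi => ?_
        rw [h (k + i + 1) (by simp only [Set.mem_Iic]; omega)]
      by_cases hω : ω ∈ A
      · simp [hω, hiff.1 hω]
      · simp [hω, mt hiff.2 hω]
    have h := G.lintegral_mul_succ x hdep (({y}ᶜ : Set V).indicator g)
    calc _ = ∫⁻ ω, A.indicator 1 ω * ({y}ᶜ : Set V).indicator g (ω (k + m + 1)) ∂(G.walk x) := by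
          refine lintegral_congr fun ω => ?_
          by_cases hω : ω ∈ A
          · by_cases hy : ω (k + m + 1) = y
            · rw [Set.indicator_of_notMem (fun h' => h'.2 m (Nat.lt_succ_self m) hy)]
              simp [hy]
            · rw [Set.indicator_of_mem, Set.indicator_of_mem hω, Set.indicator_of_mem (by simpa)]
              · simp [add_assoc]
              · refine ⟨hω.1, fun i hi => ?_⟩
                rcases Nat.lt_succ_iff_lt_or_eq.1 hi with hi | rfl
                · exact hω.2 i hi
                · exact hy
          · rw [Set.indicator_of_notMem hω, zero_mul, Set.indicator_of_notMem]
            exact fun h' => hω ⟨h'.1, fun i hi => h'.2 i (hi.trans (Nat.lt_succ_self m))⟩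
      _ = _ := h
      _ = _ := by
          refine lintegral_congr fun ω => ?_
          by_cases hω : ω ∈ A <;> simp [hω]

theorem measurableSet_visit_avoid (x y : V) (k m : ℕ) :
    MeasurableSet {ω : ℕ → V | ω k = x ∧ ∀ i, i < m → ω (k + i + 1) ≠ y} := by
  have h : MeasurableSet {ω : ℕ → V | ∀ i, i < m → ω (k + i + 1) ≠ y} := by
    simp only [Set.ofPred_forall]
    exact MeasurableSet.iInter fun i => MeasurableSet.iInter fun _ =>
      (measurableSet_eq_fun (by fun_prop) (by fun_prop)).compl
  exact (measurableSet_eq_fun (by fun_prop) (by fun_prop)).inter h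

/-- Markov property for excursions: after a visit to `x` at time `k`, the walk starts afresh. -/
theorem walk_visit_avoid (x y : V) (k m : ℕ) :
    G.walk x {ω | ω k = x ∧ ∀ i, i < m → ω (k + i + 1) ≠ y} =
      G.walk x {ω | ω k = x} * G.walk x {ω | ω 0 = x ∧ ∀ i, i < m → ω (0 + i + 1) ≠ y} := by
  have key := fun k => walk_apply_visit_succ (G := G) x y k m 1
  simp only [Pi.one_apply, lintegral_indicator_const (measurableSet_visit_avoid x y _ m),
    one_mul] at key
  have h0 : G.walk x {ω | ω 0 = x} = 1 := (prob_compl_eq_zero_iff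
    (measurableSet_eq_fun (by fun_prop) (by fun_prop))).1 (G.walk_ae_zero x)
  rw [key k, key 0, h0, one_mul]

/-- A last visit at time `k` has probability at most that of never returning, which is `0`; there
are countably many `k`. -/
theorem Recurrent.frequently_visit (hG : G.Recurrent) (x : V) :
    ∀ᵐ ω ∂(G.walk x), ∀ K, ∃ k, K ≤ k ∧ ω k = x := by
  have hnr : Tendsto (fun m => G.walk x {ω | ω 0 = x ∧ ∀ i, i < m → ω (0 + i + 1) ≠ x}) atTop
      (𝓝 0) := by
    have h := tendsto_measure_iInter_atTop (μ := G.walk x)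
      (s := fun m => {ω | ω 0 = x ∧ ∀ i, i < m → ω (0 + i + 1) ≠ x})
      (fun m => (measurableSet_visit_avoid x x 0 m).nullMeasurableSet)
      (fun m m' hm ω hω => ⟨hω.1, fun i hi => hω.2 i (hi.trans_le hm)⟩)
      ⟨0, measure_ne_top _ _⟩
    suffices h0 : G.walk x (⋂ m, {ω | ω 0 = x ∧ ∀ i, i < m → ω (0 + i + 1) ≠ x}) = 0 by
      rwa [h0] at h
    refine measure_mono_null ?_ (hG x)
    intro ω hω
    simp only [Set.mem_iInter, Set.mem_ofPred_eq] at hω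
    simp only [Set.mem_compl_iff, Set.mem_ofPred_eq, returnTime, iInf_lt_iff, not_exists]
    rintro k ⟨hk, hkx⟩ -
    exact (hω k).2 (k - 1) (by omega) (by rwa [show 0 + (k - 1) + 1 = k by omega])
  have hlast : ∀ k, ∀ᵐ ω ∂(G.walk x), ¬ (ω k = x ∧ ∀ i, ω (k + i + 1) ≠ x) := by
    intro k
    rw [ae_iff]
    simp only [not_not]
    refine le_antisymm (ge_of_tendsto' hnr fun m => ?_) zero_le
    calc G.walk x {ω | ω k = x ∧ ∀ i, ω (k + i + 1) ≠ x}
        ≤ G.walk x {ω | ω k = x ∧ ∀ i, i < m → ω (k + i + 1) ≠ x} :=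
          measure_mono fun ω hω => ⟨hω.1, fun i _ => hω.2 i⟩
      _ = _ := walk_visit_avoid x x k m
      _ ≤ _ := mul_le_of_le_one_left zero_le prob_le_one
  filter_upwards [ae_all_iff.2 hlast, G.walk_ae_zero x] with ω hω h0 K
  induction K with
  | zero => exact ⟨0, le_rfl, h0⟩
  | succ K ih =>
    obtain ⟨k, hk, hkx⟩ := ih
    by_contra! hcon
    exact hω k ⟨hkx, fun i => hcon _ (by omega)⟩

end Walk

end WeightedGraph

/-! ### Visits before hitting -/

theorem lt_hitTime_iff {V : Type*} {y : V} {ω : ℕ → V} {k : ℕ} :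
    (k : ℕ∞) < hitTime y ω ↔ ∀ i ≤ k, ω i ≠ y := by
  rw [← not_le]
  constructor
  · intro h i hi hiy
    exact h ((iInf₂_le i hiy).trans (by exact_mod_cast hi))
  · intro h hle
    have : ((k + 1 : ℕ) : ℕ∞) ≤ hitTime y ω := le_iInf₂ fun i hi => by
      have : ¬ i ≤ k := fun hik => h i hik hi
      exact_mod_cast (by omega : k + 1 ≤ i)
    have := this.trans hle
    have : k + 1 ≤ k := by exact_mod_cast this
    omega

namespace WeightedGraph

section Visits

variable {V : Type*} [MeasurableSpace V] [DiscreteMeasurableSpace V] [Countable V]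
  {G : WeightedGraph V}

theorem measurableSet_avoid (y : V) (k : ℕ) : MeasurableSet {ω : ℕ → V | ∀ i ≤ k, ω i ≠ y} := by
  simp only [Set.ofPred_forall]
  exact MeasurableSet.iInter fun i => MeasurableSet.iInter fun _ =>
    (measurableSet_eq_fun (by fun_prop) (by fun_prop)).compl

theorem lintegral_visitsBefore (x y z : V) :
    ∫⁻ ω, visitsBefore x y ω ∂(G.walk z) =
      ∑' k, G.walk z {ω | (∀ i ≤ k, ω i ≠ y) ∧ ω k = x} := by
  have hm : ∀ k, MeasurableSet {ω : ℕ → V | (∀ i ≤ k, ω i ≠ y) ∧ ω k = x} := fun k =>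
    (measurableSet_avoid y k).inter (measurableSet_eq_fun (by fun_prop) (by fun_prop))
  simp only [← lintegral_indicator_one (hm _)]
  rw [← lintegral_tsum fun k => (measurable_one.indicator (hm k)).aemeasurable]
  refine lintegral_congr fun ω => tsum_congr fun k => ?_
  simp only [lt_hitTime_iff]
  by_cases h : (∀ i ≤ k, ω i ≠ y) ∧ ω k = x
  · rw [Set.indicator_of_mem (by exact h), Set.indicator_of_mem (by exact h), Pi.one_apply]
  · rw [Set.indicator_of_notMem (by exact h), Set.indicator_of_notMem (by exact h)]

/-- If the expected number of visits before `y` is hit is finite, a recurrent walk hits `y`. -/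
theorem Recurrent.walk_avoid_eq_zero (hG : G.Recurrent) {x y : V}
    (hfin : ∫⁻ ω, visitsBefore x y ω ∂(G.walk x) ≠ ∞) :
    G.walk x {ω | ∀ i, ω i ≠ y} = 0 := by
  rw [lintegral_visitsBefore] at hfin
  -- Borel–Cantelli: almost surely only finitely many visits to `x` precede the hitting of `y`,
  -- whereas a path avoiding `y` would have infinitely many.
  have hbc := measure_limsup_atTop_eq_zero hfin
  rw [measure_eq_zero_iff_ae_notMem] at hbc ⊢
  filter_upwards [hbc, hG.frequently_visit x] with ω h1 h2 h3
  refine h1 ?_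
  rw [mem_limsup_iff_frequently_mem, frequently_atTop]
  intro K
  obtain ⟨k, hk, hkx⟩ := h2 K
  exact ⟨k, hk, fun i _ => h3 i, hkx⟩

/-- The expected number of visits to `x` before `y` is determined by a bounded solution of the
Dirichlet problem. -/
theorem Recurrent.eq_mul_lintegral_visitsBefore (hG : G.Recurrent) {x y : V} (hxy : x ≠ y)
    {a M : ℝ≥0∞} (ha : a ≠ 0) {f : V → ℝ≥0∞} (hM : M ≠ ∞) (hfM : ∀ z, f z ≤ M) (hfy : f y = 0)
    (hf : ∀ z ≠ y, G.stepOp f z + ({x} : Set V).indicator (fun _ => a) z = f z) :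
    f x = a * ∫⁻ ω, visitsBefore x y ω ∂(G.walk x) := by
  set T : ℕ → Set (ℕ → V) := fun k => {ω | ∀ i ≤ k, ω i ≠ y} with hT
  set v : ℕ → ℝ≥0∞ := fun k => G.walk x {ω | (∀ i ≤ k, ω i ≠ y) ∧ ω k = x} with hv
  set E : ℕ → ℝ≥0∞ := fun k => ∫⁻ ω, (T k).indicator 1 ω * f (ω k) ∂(G.walk x) with hE
  have hTm : ∀ k, MeasurableSet (T k) := measurableSet_avoid y
  have hE0 : E 0 = f x := by
    have : ∀ᵐ ω ∂(G.walk x), (T 0).indicator 1 ω * f (ω 0) = f x := by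
      filter_upwards [G.walk_ae_zero x] with ω h0
      rw [Set.indicator_of_mem, h0, Pi.one_apply, one_mul]
      intro i hi
      rw [Nat.le_zero.1 hi, h0]
      exact hxy
    rw [hE]
    dsimp only
    rw [lintegral_congr_ae this]
    simp
  have hstep : ∀ k, E (k + 1) + a * v k = E k := by
    intro k
    have hdep : DependsOn ((T k).indicator (1 : (ℕ → V) → ℝ≥0∞)) (Set.Iic k) := by
      intro ω ω' h
      have hiff : ω ∈ T k ↔ ω' ∈ T k := by
        simp only [hT, Set.mem_ofPred_eq]
        refine forall₂_congr fun i hi => ?_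
        rw [h i hi]
      by_cases hω : ω ∈ T k
      · simp [hω, hiff.1 hω]
      · simp [hω, mt hiff.2 hω]
    -- As `f y = 0`, the event `T (k + 1)` may be replaced by `T k`, which depends only on times up
    -- to `k`, as the Markov property requires.
    have h1 : E (k + 1) = ∫⁻ ω, (T k).indicator 1 ω * f (ω (k + 1)) ∂(G.walk x) := by
      refine lintegral_congr fun ω => ?_
      by_cases hy : ω (k + 1) = y
      · simp [hy, hfy]
      · congr 1
        have hiff : ω ∈ T (k + 1) ↔ ω ∈ T k := by
          refine ⟨fun h i hi => h i (by omega), fun h i hi => ?_⟩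
          rcases Nat.le_succ_iff.1 hi with hi | rfl
          · exact h i hi
          · exact hy
        by_cases hω : ω ∈ T k
        · rw [Set.indicator_of_mem hω, Set.indicator_of_mem (hiff.2 hω)]
        · rw [Set.indicator_of_notMem hω, Set.indicator_of_notMem (mt hiff.1 hω)]
    have hvm : MeasurableSet {ω : ℕ → V | (∀ i ≤ k, ω i ≠ y) ∧ ω k = x} :=
      (measurableSet_avoid y k).inter (measurableSet_eq_fun (by fun_prop) (by fun_prop))
    have h2 : a * v k =
        ∫⁻ ω, (T k).indicator 1 ω * ({x} : Set V).indicator (fun _ => a) (ω k) ∂(G.walk x) := by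
      rw [hv]
      dsimp only
      rw [← lintegral_indicator_const hvm]
      refine lintegral_congr fun ω => ?_
      by_cases hω : ω ∈ T k
      · by_cases hx : ω k = x
        · rw [Set.indicator_of_mem (by exact ⟨hω, hx⟩)]
          simp [hω, hx]
        · rw [Set.indicator_of_notMem fun h => hx h.2]
          simp [hx]
      · rw [Set.indicator_of_notMem fun h => hω h.1]
        simp [hω]
    have hindm : Measurable ((T k).indicator (1 : (ℕ → V) → ℝ≥0∞)) :=
      measurable_one.indicator (hTm k)
    have hgm : ∀ g : V → ℝ≥0∞, Measurable fun ω : ℕ → V => g (ω k) := fun g =>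
      (Measurable.of_discrete (f := g)).comp (measurable_pi_apply k)
    rw [h1, G.lintegral_mul_succ x hdep, h2,
      ← lintegral_add_left
      (f := fun ω => (T k).indicator 1 ω * G.stepOp f (ω k)) (hindm.mul (hgm (G.stepOp f)))]
    refine lintegral_congr fun ω => ?_
    by_cases hω : ω ∈ T k
    · simp only [Set.indicator_of_mem hω, Pi.one_apply, one_mul]
      exact hf _ (hω k le_rfl)
    · simp [hω]
  have hsum : ∀ N, E N + a * ∑ k ∈ Finset.range N, v k = f x := by
    intro N
    induction N with
    | zero => simp [hE0]
    | succ N ih =>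
      rw [Finset.sum_range_succ, mul_add, ← ih, ← hstep N]
      ring
  have hvis : ∫⁻ ω, visitsBefore x y ω ∂(G.walk x) = ∑' k, v k := lintegral_visitsBefore x y x
  have hlim : Tendsto (fun N => a * ∑ k ∈ Finset.range N, v k) atTop (𝓝 (a * ∑' k, v k)) :=
    -- Here `a` is finite: otherwise the equation at `x` would make `f x` infinite.
    ENNReal.Tendsto.const_mul (ENNReal.tendsto_nat_tsum v) (.inr (by
      rintro rfl
      have := hf x hxy
      rw [Set.indicator_of_mem (Set.mem_singleton x), add_top] at this
      exact hM (top_le_iff.1 (this ▸ hfM x))))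
  have hle : a * ∑' k, v k ≤ f x := le_of_tendsto' hlim fun N => hsum N ▸ le_add_self
  have hfin : ∑' k, v k ≠ ∞ := by
    intro h
    rw [h, ENNReal.mul_top ha, top_le_iff] at hle
    exact hM (top_le_iff.1 (hle ▸ hfM x))
  have hT0 : Tendsto (fun k => G.walk x (T k)) atTop (𝓝 0) := by
    have h := tendsto_measure_iInter_atTop (μ := G.walk x) (s := T)
      (fun k => (hTm k).nullMeasurableSet) (fun k k' hk ω hω i hi => hω i (hi.trans hk))
      ⟨0, measure_ne_top _ _⟩
    have hsub : ⋂ k, T k ⊆ {ω | ∀ i, ω i ≠ y} := fun ω hω i =>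
      (show ∀ j ≤ i, ω j ≠ y from Set.mem_iInter.1 hω i) i le_rfl
    rwa [measure_mono_null hsub (hG.walk_avoid_eq_zero (hvis ▸ hfin))] at h
  have hEle : ∀ k, E k ≤ M * G.walk x (T k) := fun k => by
    rw [← lintegral_indicator_const (hTm k)]
    refine lintegral_mono fun ω => ?_
    by_cases hω : ω ∈ T k
    · simpa [hω] using hfM _
    · simp [hω]
  have hE0' : Tendsto E atTop (𝓝 0) := by
    refine tendsto_of_tendsto_of_tendsto_of_le_of_le tendsto_const_nhds ?_ (fun _ => zero_le) hEle
    simpa using ENNReal.Tendsto.const_mul hT0 (.inr hM)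
  have := hE0'.add hlim
  simp only [hsum, zero_add] at this
  rw [hvis]
  exact tendsto_nhds_unique tendsto_const_nhds this

end Visits

end WeightedGraph

/-! ### Conclusion -/

theorem mainTheorem7 {V : Type*} [Countable V] [Infinite V]
    [MeasurableSpace V] [DiscreteMeasurableSpace V]
    (R : V → V → ℝ≥0) (hR : IsResistanceMetric R)
    (W : ℕ → Finset V) (hW : IsFiniteExhaustion W)
    (G : ∀ n, WeightedGraph (W n))
    (hconn : ∀ n, (G n).Connected)
    (hres : ∀ n, (G n).HasEffectiveResistance (fun x y => R x y))
    (hlim : ∀ v : V, (WeightedGraph.limitGraph G).vertexWeight v < ∞ ∧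
      Tendsto (fun n => (G n).extend.vertexWeight v) atTop
        (𝓝 ((WeightedGraph.limitGraph G).vertexWeight v)))
    (hrec : (WeightedGraph.limitGraph G).Recurrent) (x y : V) :
    (R x y : ℝ≥0∞) =
      1 / (WeightedGraph.limitGraph G).vertexWeight x *
        ∫⁻ ω, visitsBefore x y ω ∂((WeightedGraph.limitGraph G).walk x) := by
  classical
  have hself := WeightedGraph.self_eq_zero_of_exhaustion hW hres
  by_cases hxy : x = y
  · subst hxy
    have h0 : ∀ᵐ ω ∂((WeightedGraph.limitGraph G).walk x), visitsBefore x x ω = 0 := by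
      filter_upwards [(WeightedGraph.limitGraph G).walk_ae_zero x] with ω h0
      refine ENNReal.tsum_eq_zero.2 fun k => Set.indicator_of_notMem ?_ _
      exact fun h => lt_hitTime_iff.1 h.1 0 (Nat.zero_le k) h0
    rw [hself, lintegral_congr_ae h0]
    simp
  -- If `c_z` were `0`, the limit equation with source `z` and any other vertex as sink would equate
  -- a quantity at least `1` with `0`.
  have hne : ∀ z, (WeightedGraph.limitGraph G).vertexWeight z ≠ 0 := by
    intro z hz
    obtain ⟨w, hw⟩ := exists_ne z
    have h := WeightedGraph.limitGraph_tsum_mul_pot hW hconn hres hlim z hw.symm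
    rw [hz, zero_mul, if_pos rfl] at h
    exact one_ne_zero (add_eq_zero.1 h).2
  have hfx : ENNReal.ofReal (WeightedGraph.pot R x y x) = R x y := by
    simp [WeightedGraph.pot, hself]
  rw [← hfx, one_div]
  refine hrec.eq_mul_lintegral_visitsBefore hxy (ENNReal.inv_ne_zero.2 (hlim x).1.ne)
    (f := fun z => ENNReal.ofReal (WeightedGraph.pot R x y z)) (M := R x y) ENNReal.coe_ne_top
    (fun z => ?_) ?_ fun z hz => ?_
  · rw [← ENNReal.ofReal_coe_nnreal]
    exact ENNReal.ofReal_le_ofReal (WeightedGraph.pot_mem_Icc hW hconn hres x y z).2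
  · simp [WeightedGraph.pot, hself]
  · have h := WeightedGraph.limitGraph_tsum_mul_pot hW hconn hres hlim x hz
    have hz0 := hne z
    have hzt := (hlim z).1.ne
    rw [WeightedGraph.stepOp_eq _ hz0 hzt]
    have hind : ({x} : Set V).indicator
        (fun _ => ((WeightedGraph.limitGraph G).vertexWeight x)⁻¹) z =
        ((WeightedGraph.limitGraph G).vertexWeight z)⁻¹ * (if z = x then 1 else 0) := by
      by_cases hzx : z = x
      · subst hzx; simp
      · simp [hzx]
    rw [hind, ← mul_add, h, ← mul_assoc, ENNReal.inv_mul_cancel hz0 hzt, one_mul]
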